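/- **Theorem 2.1.** Let $D$ be a (nondegenerate) convex quadrilateral in the Euclidean plane, and let $E$ be any ellipse inscribed in $D$, that is, an ellipse (possibly a circle) contained in $D$ and tangent to each of the four sides of $D$. Then $$\frac{\operatorname{Area}(E)}{\operatorname{Area}(D)}\le\frac{\pi}{4},$$ where $\operatorname{Area}(E)$ and $\operatorname{Area}(D)$ are the areas of the regions bounded by $E$ and $D$. Equality holds if and only if $D$ is a parallelogram and $E$ is tangent to the four sides of $D$ at their midpoints. -/

import Mathlib

/-- The Euclidean plane. -/
abbrev Plane : Type := EuclideanSpace ℝ (Fin 2)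

/-- The area (two-dimensional Lebesgue measure) of a plane set, as a real number. -/
noncomputable def area (S : Set Plane) : ℝ := (MeasureTheory.volume S).toReal

/-- An ellipse, given by its centre, an orthonormal frame of axis directions, and the lengths
`a, b > 0` of the two semi-axes (circles, `a = b`, are allowed). -/
structure Ellipse where
  center : Plane
  axes : OrthonormalBasis (Fin 2) ℝ Plane
  a : ℝ
  b : ℝ
  a_pos : 0 < a
  b_pos : 0 < b

namespace Ellipse

/-- `X ^ 2 / a ^ 2 + Y ^ 2 / b ^ 2`, where `(X, Y)` are the coordinates of `p` in the frame of the
axes of the ellipse, with origin at its centre. -/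
noncomputable def form (E : Ellipse) (p : Plane) : ℝ :=
  (E.axes.repr (p - E.center) 0) ^ 2 / E.a ^ 2 + (E.axes.repr (p - E.center) 1) ^ 2 / E.b ^ 2

/-- The ellipse as a curve. -/
def curve (E : Ellipse) : Set Plane := {p | E.form p = 1}

/-- The closed region bounded by the ellipse. -/
def region (E : Ellipse) : Set Plane := {p | E.form p ≤ 1}

/-- The line `l` is tangent to the ellipse at the point `q`: it meets the curve in `q` only. -/
def TangentAt (E : Ellipse) (l : AffineSubspace ℝ Plane) (q : Plane) : Prop :=
  (l : Set Plane) ∩ E.curve = {q}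

end Ellipse

namespace Polygon

/-- The line through the consecutive vertices `D i` and `D (i + 1)` of a quadrilateral. -/
noncomputable def sideLine (D : Polygon Plane 4) (i : Fin 4) : AffineSubspace ℝ Plane :=
  affineSpan ℝ {D i, D (i + 1)}

/-- The quadrilateral with consecutive vertices `D 0, D 1, D 2, D 3` is convex (and
nondegenerate): for each side, the two remaining vertices lie strictly on the same side of the
line through it. -/
def IsConvexQuadrilateral (D : Polygon Plane 4) : Prop :=
  ∀ i : Fin 4, (D.sideLine i).SSameSide (D (i + 2)) (D (i + 3))

/-- The closed region bounded by a convex quadrilateral. -/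
def region (D : Polygon Plane 4) : Set Plane := convexHull ℝ (Set.range D.vertices)

/-- Opposite sides are parallel. -/
def IsParallelogram (D : Polygon Plane 4) : Prop :=
  (D.sideLine 0).Parallel (D.sideLine 2) ∧ (D.sideLine 1).Parallel (D.sideLine 3)

end Polygon

namespace Ellipse

/-- `E` is inscribed in the quadrilateral `D`: it lies in `D` and is tangent to each of the four
sides of `D` at a point of that side. -/
def InscribedIn (E : Ellipse) (D : Polygon Plane 4) : Prop :=
  E.region ⊆ D.region ∧
    ∀ i : Fin 4, ∃ q ∈ segment ℝ (D i) (D (i + 1)), E.TangentAt (D.sideLine i) q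

/-- `E` is tangent to each of the four sides of `D` at the midpoint of that side. -/
def TangentAtMidpoints (E : Ellipse) (D : Polygon Plane 4) : Prop :=
  ∀ i : Fin 4, E.TangentAt (D.sideLine i) (midpoint ℝ (D i) (D (i + 1)))

end Ellipse

/-!
An affine map changes all areas by the same factor and preserves tangency, midpoints and
parallelism, so `E` may be taken to be the unit circle of `ℂ` and `D` to be traversed
counterclockwise. If the sides touch the circle at `u₀, …, u₃` and the tangent segments from the
vertices have lengths `t₀, …, t₃`, then the `i`-th vertex is both `uᵢ (1 - tᵢ I)` and
`uᵢ₋₁ (1 + tᵢ I)`. Multiplying over all vertices cancels the `uᵢ` and gives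
`∏ (1 + tᵢ I) = ∏ (1 - tᵢ I)`; for four sides the imaginary part says that the first and third
elementary symmetric functions of the `tᵢ` agree. The area of `D` is `∑ tᵢ`, and this relation
forces `∑ tᵢ ≥ 4`, with equality exactly when all `tᵢ = 1`, that is, when `D` is a square.
-/

open Complex EuclideanGeometry MeasureTheory
open scoped ComplexConjugate RealInnerProductSpace

/-! ### Areas of triangles and convex quadrilaterals -/

/-- Twice the signed area of the triangle `a b c`, as an affine function of `c`. It vanishes on the
line through `a` and `b`, and is positive to the left of the directed line from `a` to `b`. -/
noncomputable def doubleArea (a b : ℂ) : ℂ →ᵃ[ℝ] ℝ :=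
  ((b - a).re • imLm - (b - a).im • reLm).toAffineMap.comp
    (AffineMap.id ℝ ℂ - AffineMap.const ℝ ℂ a)

theorem doubleArea_apply (a b c : ℂ) :
    doubleArea a b c = (b - a).re * (c - a).im - (b - a).im * (c - a).re := by
  rfl

theorem doubleArea_apply_left (a b : ℂ) : doubleArea a b a = 0 := by
  simp [doubleArea_apply]

theorem doubleArea_apply_right (a b : ℂ) : doubleArea a b b = 0 := by
  simp only [doubleArea_apply]; ring

theorem doubleArea_rotate (a b c : ℂ) : doubleArea b c a = doubleArea a b c := by
  simp only [doubleArea_apply, sub_re, sub_im]; ring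

theorem doubleArea_swap (a b c : ℂ) : doubleArea b a c = -doubleArea a b c := by
  simp only [doubleArea_apply, sub_re, sub_im]; ring

theorem doubleArea_conj (a b c : ℂ) :
    doubleArea (conj a) (conj b) (conj c) = -doubleArea a b c := by
  simp only [doubleArea_apply, sub_re, sub_im, conj_re, conj_im]; ring

theorem mem_line_iff_doubleArea_eq_zero {a b : ℂ} (hab : a ≠ b) (c : ℂ) :
    c ∈ line[ℝ, a, b] ↔ doubleArea a b c = 0 := by
  rw [mem_affineSpan_pair_iff_exists_lineMap_eq]
  constructor
  · rintro ⟨r, rfl⟩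
    rw [AffineMap.apply_lineMap, doubleArea_apply_left, doubleArea_apply_right,
      AffineMap.lineMap_same_apply]
  · intro h
    have hba : b - a ≠ 0 := sub_ne_zero.2 hab.symm
    have hreal : ((c - a) / (b - a)).im = 0 := by
      rw [doubleArea_apply] at h
      rw [div_im, ← sub_div, mul_comm, mul_comm _ (b - a).im, h, zero_div]
    refine ⟨((c - a) / (b - a)).re, ?_⟩
    have hcoe : (((c - a) / (b - a)).re : ℂ) = (c - a) / (b - a) := Complex.ext rfl hreal.symm
    rw [AffineMap.lineMap_apply, vsub_eq_sub, vadd_eq_add, real_smul, hcoe,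
      div_mul_cancel₀ _ hba, sub_add_cancel]

theorem convex_doubleArea_nonneg (a b : ℂ) : Convex ℝ {z | 0 ≤ doubleArea a b z} :=
  (convex_Ici (0 : ℝ)).affine_preimage (doubleArea a b)

theorem mem_convexHull_triple_iff {a b c : ℂ} (h : 0 < doubleArea a b c) (z : ℂ) :
    z ∈ convexHull ℝ {a, b, c} ↔
      0 ≤ doubleArea a b z ∧ 0 ≤ doubleArea b c z ∧ 0 ≤ doubleArea c a z := by
  have hb : 0 < doubleArea b c a := by rwa [doubleArea_rotate]
  have hc : 0 < doubleArea c a b := by rwa [doubleArea_rotate, doubleArea_rotate]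
  constructor
  · have hsub : convexHull ℝ {a, b, c} ⊆ {z | 0 ≤ doubleArea a b z} ∩
        ({z | 0 ≤ doubleArea b c z} ∩ {z | 0 ≤ doubleArea c a z}) := by
      refine convexHull_min ?_ ((convex_doubleArea_nonneg a b).inter
        ((convex_doubleArea_nonneg b c).inter (convex_doubleArea_nonneg c a)))
      rintro z (rfl | rfl | rfl) <;>
        simp [doubleArea_apply_left, doubleArea_apply_right, h.le, hb.le, hc.le]
    exact fun hz => hsub hz
  · rintro ⟨hab, hbc, hca⟩
    have hsum : doubleArea b c z + doubleArea c a z + doubleArea a b z = doubleArea a b c := by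
      simp only [doubleArea_apply, sub_re, sub_im]; ring
    have hbary : z = ∑ i, (![doubleArea b c z, doubleArea c a z, doubleArea a b z] i /
        doubleArea a b c) • ![a, b, c] i := by
      simp only [Fin.sum_univ_three, Matrix.cons_val, div_eq_inv_mul, mul_smul, ← smul_add]
      rw [eq_inv_smul_iff₀ h.ne']
      apply Complex.ext <;>
        simp only [doubleArea_apply, real_smul, sub_re, sub_im, add_re, add_im, mul_re, mul_im,
          ofReal_re, ofReal_im] <;> ring
    rw [hbary]
    refine (convex_convexHull ℝ _).sum_mem (fun i _ => ?_) ?_ fun i _ => subset_convexHull ℝ _ ?_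
    · fin_cases i <;> exact div_nonneg ‹_› h.le
    · simp only [Fin.sum_univ_three, Matrix.cons_val, ← add_div, hsum, div_self h.ne']
    · fin_cases i <;> simp

theorem convexHull_zero_one_I :
    convexHull ℝ {0, 1, I} = {z : ℂ | 0 ≤ z.re ∧ 0 ≤ z.im ∧ z.re + z.im ≤ 1} := by
  ext z
  rw [mem_convexHull_triple_iff (by simp [doubleArea_apply])]
  simp only [doubleArea_apply, sub_re, sub_im, zero_re, zero_im, one_re, one_im, I_re, I_im,
    Set.mem_ofPred_eq]
  constructor <;> rintro ⟨h1, h2, h3⟩ <;> refine ⟨?_, ?_, ?_⟩ <;> linarith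

theorem prod_volume_setOf_mem_Icc {α : Type*} [MeasurableSpace α] {μ : Measure α} {f g : α → ℝ}
    {s : Set α} (hf : Measurable f) (hg : Measurable g) (hs : MeasurableSet s) :
    (μ.prod volume) {p | p.1 ∈ s ∧ p.2 ∈ Set.Icc (f p.1) (g p.1)} =
      ∫⁻ x in s, ENNReal.ofReal (g x - f x) ∂μ := by
  rw [Measure.prod_apply (measurableSet_region_between_cc hf hg hs), ← lintegral_indicator hs]
  refine lintegral_congr fun x => ?_
  by_cases hx : x ∈ s
  · rw [Set.indicator_of_mem hx, ← Real.volume_Icc]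
    congr 1
    ext y
    simp [hx]
  · simp [hx]

theorem volume_setOf_re_im_add_le_one :
    volume {z : ℂ | 0 ≤ z.re ∧ 0 ≤ z.im ∧ z.re + z.im ≤ 1} = ENNReal.ofReal (1 / 2) := by
  have hpre : {z : ℂ | 0 ≤ z.re ∧ 0 ≤ z.im ∧ z.re + z.im ≤ 1} =
      measurableEquivRealProd ⁻¹' {p | p.1 ∈ Set.Icc (0 : ℝ) 1 ∧ p.2 ∈ Set.Icc 0 (1 - p.1)} := by
    ext z
    simp only [Set.mem_ofPred_eq, Set.mem_preimage, Set.mem_Icc, measurableEquivRealProd_apply]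
    constructor
    · rintro ⟨hre, him, hsum⟩
      refine ⟨⟨hre, ?_⟩, him, ?_⟩ <;> linarith
    · rintro ⟨⟨hre, -⟩, him, hsum⟩
      exact ⟨hre, him, by linarith⟩
  rw [hpre, volume_preserving_equiv_real_prod.measure_preimage_equiv, Measure.volume_eq_prod,
    prod_volume_setOf_mem_Icc measurable_const (by fun_prop) measurableSet_Icc,
    ← ofReal_integral_eq_lintegral_ofReal]
  · congr 1
    rw [integral_Icc_eq_integral_Ioc, ← intervalIntegral.integral_of_le zero_le_one]
    simp only [sub_zero]
    rw [intervalIntegral.integral_comp_sub_left (fun x => x)]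
    norm_num
  · exact Continuous.integrableOn_Icc (by fun_prop)
  · filter_upwards [ae_restrict_mem measurableSet_Icc] with x hx
    simpa using hx.2

theorem det_basisOneI_constr (u v : ℂ) :
    LinearMap.det (basisOneI.constr ℝ ![u, v]) = u.re * v.im - u.im * v.re := by
  rw [← LinearMap.det_toMatrix basisOneI, Matrix.det_fin_two]
  simp only [LinearMap.toMatrix_apply, Module.Basis.constr_basis, coe_basisOneI_repr,
    Matrix.cons_val]
  ring

theorem measure_image_affineMap {E F : Type*} [AddCommGroup E] [Module ℝ E] [AddCommGroup F]
    [Module ℝ F] [MeasurableSpace F] [MeasurableAdd F] (ν : Measure F) [ν.IsAddRightInvariant]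
    (f : E →ᵃ[ℝ] F) (s : Set E) : ν (f '' s) = ν (f.linear '' s) := by
  have himage : f '' s = (fun y => y + f 0) '' (f.linear '' s) := by
    rw [Set.image_image]
    exact Set.image_congr fun x _ => congrFun f.decomp x
  rw [himage, Set.image_add_right, measure_preimage_add_right]

theorem exists_measure_image_affineEquiv {E F : Type*} [NormedAddCommGroup E] [NormedSpace ℝ E]
    [FiniteDimensional ℝ E] [MeasurableSpace E] [BorelSpace E] [NormedAddCommGroup F]
    [NormedSpace ℝ F] [MeasurableSpace F] [BorelSpace F] (μ : Measure E) [μ.IsAddHaarMeasure]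
    (ν : Measure F) [ν.IsAddHaarMeasure] (T : E ≃ᵃ[ℝ] F) :
    ∃ c : NNReal, c ≠ 0 ∧ ∀ s, ν (T '' s) = c * μ s := by
  have : FiniteDimensional ℝ F := T.linear.finiteDimensional
  let L : F ≃L[ℝ] E := T.linear.symm.toContinuousLinearEquiv
  refine ⟨(ν.map L).addHaarScalarFactor μ,
    (Measure.addHaarScalarFactor_pos_of_isAddHaarMeasure _ _).ne', fun s => ?_⟩
  calc ν (T '' s) = ν (T.linear '' s) := measure_image_affineMap ν T.toAffineMap s
    _ = (ν.map L) s := by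
        have hL : MeasurableEmbedding L := L.toHomeomorph.measurableEmbedding
        rw [hL.map_apply]
        exact congrArg ν (T.linear.image_eq_preimage_symm s)
    _ = _ := congrArg (· s) (Measure.isAddLeftInvariant_eq_smul (ν.map L) μ)

theorem volume_convexHull_triple {a b c : ℂ} (h : 0 < doubleArea a b c) :
    volume (convexHull ℝ {a, b, c}) = ENNReal.ofReal (doubleArea a b c / 2) := by
  let f : ℂ →ᵃ[ℝ] ℂ := (basisOneI.constr ℝ ![b - a, c - a]).toAffineMap + AffineMap.const ℝ ℂ a
  have hlinear : f.linear = basisOneI.constr ℝ ![b - a, c - a] := by simp [f]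
  have himage : f '' {0, 1, I} = {a, b, c} := by
    simp [f, Set.image_insert_eq, Module.Basis.constr_apply_fintype]
  rw [← himage, ← f.image_convexHull, measure_image_affineMap, hlinear,
    Measure.addHaar_image_linearMap, det_basisOneI_constr, ← doubleArea_apply, abs_of_pos h,
    convexHull_zero_one_I, volume_setOf_re_im_add_le_one, ← ENNReal.ofReal_mul h.le, mul_one_div]

theorem aedisjoint_convexHull_triple {a b c d : ℂ} (hb : 0 < doubleArea a b c)
    (hd : 0 < doubleArea c d a) :
    AEDisjoint volume (convexHull ℝ {a, b, c}) (convexHull ℝ {c, d, a}) := by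
  have hb' : 0 < doubleArea c a b := by rwa [doubleArea_rotate, doubleArea_rotate]
  have hne : c ≠ a := by
    rintro rfl
    exact hd.ne' (doubleArea_apply_left _ _)
  have hsub : convexHull ℝ {a, b, c} ∩ convexHull ℝ {c, d, a} ⊆ line[ℝ, c, a] := by
    rintro z ⟨hz, hz'⟩
    have hge := ((mem_convexHull_triple_iff hb z).1 hz).2.2
    have hle := ((mem_convexHull_triple_iff hd z).1 hz').2.2
    rw [doubleArea_swap, Left.nonneg_neg_iff] at hle
    exact (mem_line_iff_doubleArea_eq_zero hne z).2 (le_antisymm hle hge)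
  refine measure_mono_null hsub (Measure.addHaar_affineSubspace volume _ fun htop => hb'.ne' ?_)
  exact (mem_line_iff_doubleArea_eq_zero hne b).1 (htop ▸ AffineSubspace.mem_top ℝ ℂ b)

/-- The vertices of a convex quadrilateral, listed in counterclockwise order: the boundary turns
left at each vertex. -/
def IsCounterclockwise (v : Fin 4 → ℂ) : Prop :=
  ∀ i, 0 < doubleArea (v i) (v (i + 1)) (v (i + 2))

namespace IsCounterclockwise

variable {v : Fin 4 → ℂ}

theorem convexHull_subset (hv : IsCounterclockwise v) (i : Fin 4) :
    convexHull ℝ (Set.range v) ⊆ {z | 0 ≤ doubleArea (v i) (v (i + 1)) z} := by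
  refine convexHull_min ?_ (convex_doubleArea_nonneg _ _)
  rintro _ ⟨j, rfl⟩
  obtain ⟨k, rfl⟩ : ∃ k, j = i + k := ⟨j - i, by simp⟩
  rw [Set.mem_ofPred_eq]
  fin_cases k
  · simp [doubleArea_apply_left]
  · exact (doubleArea_apply_right _ _).ge
  · exact (hv i).le
  · have hprev : 0 < doubleArea (v (i + 3)) (v (i + 3 + 1)) (v (i + 3 + 2)) := hv (i + 3)
    rw [show i + 3 + 1 = i by rw [add_assoc]; simp, show i + 3 + 2 = i + 1 by rw [add_assoc]; rfl,
      ← doubleArea_rotate] at hprev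
    exact hprev.le

theorem convexHull_eq_union (hv : IsCounterclockwise v) :
    convexHull ℝ (Set.range v) =
      convexHull ℝ {v 0, v 1, v 2} ∪ convexHull ℝ {v 2, v 3, v 0} := by
  apply Set.Subset.antisymm
  · intro z hz
    have hside i : 0 ≤ doubleArea (v i) (v (i + 1)) z := hv.convexHull_subset i hz
    rcases le_total 0 (doubleArea (v 2) (v 0) z) with hdiag | hdiag
    · exact Or.inl ((mem_convexHull_triple_iff (hv 0) z).2 ⟨hside 0, hside 1, hdiag⟩)
    · refine Or.inr ((mem_convexHull_triple_iff (hv 2) z).2 ⟨hside 2, hside 3, ?_⟩)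
      change 0 ≤ doubleArea (v 0) (v 2) z
      rw [doubleArea_swap]
      exact neg_nonneg.2 hdiag
  · apply Set.union_subset <;> apply convexHull_mono <;> grind

theorem volume_convexHull (hv : IsCounterclockwise v) :
    volume.real (convexHull ℝ (Set.range v)) =
      (doubleArea (v 0) (v 1) (v 2) + doubleArea (v 2) (v 3) (v 0)) / 2 := by
  have h0 : 0 < doubleArea (v 0) (v 1) (v 2) := hv 0
  have h2 : 0 < doubleArea (v 2) (v 3) (v 0) := hv 2
  have hmeas : MeasurableSet (convexHull ℝ {v 2, v 3, v 0}) :=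
    (Set.toFinite _).isCompact_convexHull ℝ |>.isClosed.measurableSet
  rw [hv.convexHull_eq_union, measureReal_def,
    measure_union₀ hmeas.nullMeasurableSet (aedisjoint_convexHull_triple h0 h2),
    volume_convexHull_triple h0, volume_convexHull_triple h2,
    ← ENNReal.ofReal_add (by positivity) (by positivity),
    ENNReal.toReal_ofReal (by positivity), add_div]

end IsCounterclockwise

/-! ### Polygons circumscribed about the unit circle -/

theorem isTangentAt_of_inter_eq_singleton {V P : Type*} [NormedAddCommGroup V]
    [InnerProductSpace ℝ V] [MetricSpace P] [NormedAddTorsor V P] {s : Sphere P}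
    {l : AffineSubspace ℝ P} {p : P} (h : (l : Set P) ∩ s = {p}) : s.IsTangentAt p l := by
  obtain ⟨hl, hs⟩ : p ∈ (l : Set P) ∩ s := h ▸ rfl
  refine ⟨hs, hl, fun x hx => ?_⟩
  have hsecond : s.secondInter p (x -ᵥ p) ∈ (l : Set P) ∩ s :=
    ⟨l.smul_vsub_vadd_mem _ hx hl hl, (Sphere.secondInter_mem _).2 hs⟩
  rw [h, Set.mem_singleton_iff, Sphere.secondInter_eq_self_iff] at hsecond
  exact Sphere.mem_orthRadius_iff_inner_left.2 hsecond

theorem norm_eq_one_of_isTangentAt {u : ℂ} {l : AffineSubspace ℝ ℂ}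
    (h : (⟨0, 1⟩ : Sphere ℂ).IsTangentAt u l) : ‖u‖ = 1 :=
  mem_sphere_zero_iff_norm.1 h.mem_sphere

theorem exists_eq_mul_one_add_of_isTangentAt {u x : ℂ} {l : AffineSubspace ℝ ℂ}
    (h : (⟨0, 1⟩ : Sphere ℂ).IsTangentAt u l) (hx : x ∈ l) : ∃ p : ℝ, x = u * (1 + p * I) := by
  have hu : conj u * u = 1 := by
    rw [conj_mul', norm_eq_one_of_isTangentAt h, ofReal_one, one_pow]
  have horth : (conj u * (x - u)).re = 0 := by
    rw [mul_comm, ← Complex.inner, real_inner_comm]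
    simpa using h.inner_left_eq_zero_of_mem hx
  refine ⟨(conj u * (x - u)).im, ?_⟩
  have hI : conj u * (x - u) = (conj u * (x - u)).im * I := by
    apply Complex.ext <;> simp [horth]
  rw [mul_add, ← hI]
  linear_combination (u - x) * hu

theorem doubleArea_mul_one_add {u : ℂ} (hu : ‖u‖ = 1) (p q : ℝ) :
    doubleArea (u * (1 + p * I)) (u * (1 + q * I)) 0 = q - p := by
  have hsq : u.re ^ 2 + u.im ^ 2 = 1 := by
    rw [← one_pow 2, ← hu, Complex.sq_norm, normSq_apply, sq, sq]
  simp only [doubleArea_apply, sub_re, sub_im, mul_re, mul_im, add_re, add_im, one_re, one_im,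
    ofReal_re, ofReal_im, I_re, I_im, zero_re, zero_im]
  linear_combination (q - p) * hsq

theorem dist_mul_one_add {u : ℂ} (hu : ‖u‖ = 1) (p : ℝ) : dist (u * (1 + p * I)) u = |p| := by
  rw [dist_eq, mul_add, mul_one, add_sub_cancel_left]
  simp [hu]

theorem eq_mul_one_sub_and_eq_mul_one_add_of_isTangentAt {a b u : ℂ}
    (h : (⟨0, 1⟩ : Sphere ℂ).IsTangentAt u line[ℝ, a, b])
    (hu : u ∈ segment ℝ a b) (h0 : 0 ≤ doubleArea a b 0) :
    a = u * (1 - dist a u * I) ∧ b = u * (1 + dist b u * I) := by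
  have hnorm : ‖u‖ = 1 := norm_eq_one_of_isTangentAt h
  obtain ⟨p, rfl⟩ := exists_eq_mul_one_add_of_isTangentAt h (left_mem_affineSpan_pair ℝ a b)
  obtain ⟨q, rfl⟩ := exists_eq_mul_one_add_of_isTangentAt h (right_mem_affineSpan_pair ℝ _ b)
  rw [doubleArea_mul_one_add hnorm] at h0
  obtain ⟨α, β, hα, hβ, hαβ, hcomb⟩ := hu
  have hzero : α * p + β * q = 0 := by
    have hαβ' : (α + β : ℂ) = 1 := mod_cast hαβ
    have hu0 : u ≠ 0 := norm_ne_zero_iff.1 (by simp [hnorm])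
    have hmul : u * I * ((α * p + β * q : ℝ) : ℂ) = 0 := by
      simp only [real_smul] at hcomb
      push_cast
      linear_combination hcomb - u * hαβ'
    exact_mod_cast (mul_eq_zero.1 hmul).resolve_left (mul_ne_zero hu0 I_ne_zero)
  have hp : p ≤ 0 := by
    rw [show p = -(β * (q - p)) by linear_combination hzero - p * hαβ]
    exact neg_nonpos.2 (mul_nonneg hβ h0)
  have hq : 0 ≤ q := by
    rw [show q = α * (q - p) by linear_combination hzero - q * hαβ]
    exact mul_nonneg hα h0
  rw [dist_mul_one_add hnorm, dist_mul_one_add hnorm, abs_of_nonpos hp, abs_of_nonneg hq,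
    ofReal_neg, neg_mul, sub_neg_eq_add]
  exact ⟨rfl, rfl⟩

section

variable {a b c d : ℝ}

-- With `x = a + b` and `y = c + d` the hypothesis reads `x + y = a * b * y + c * d * x`; now use
-- `4 * a * b = x ^ 2 - (a - b) ^ 2`, `4 * c * d = y ^ 2 - (c - d) ^ 2` and
-- `4 * x * y = (x + y) ^ 2 - (x - y) ^ 2`.
theorem sum_mul_sub_four_eq (h : a + b + c + d = a * b * c + a * b * d + a * c * d + b * c * d) :
    (a + b + c + d) * (a + b + c + d - 4) * (a + b + c + d + 4) =
      4 * (c + d) * (a - b) ^ 2 + 4 * (a + b) * (c - d) ^ 2 +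
        (a + b + c + d) * (a + b - c - d) ^ 2 := by
  linear_combination -16 * h

theorem four_le_sum_of_eq_esymm (ha : 0 ≤ a) (hb : 0 ≤ b) (hc : 0 ≤ c) (hd : 0 ≤ d)
    (hpos : 0 < a + b + c + d)
    (h : a + b + c + d = a * b * c + a * b * d + a * c * d + b * c * d) :
    4 ≤ a + b + c + d := by
  have hnonneg : 0 ≤ (a + b + c + d) * (a + b + c + d - 4) * (a + b + c + d + 4) := by
    rw [sum_mul_sub_four_eq h]
    positivity
  exact sub_nonneg.1 (nonneg_of_mul_nonneg_right
    (nonneg_of_mul_nonneg_left hnonneg (by positivity)) hpos)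

theorem eq_one_of_sum_eq_four (ha : 0 ≤ a) (hb : 0 ≤ b) (hc : 0 ≤ c) (hd : 0 ≤ d)
    (hsum : a + b + c + d = 4)
    (h : a + b + c + d = a * b * c + a * b * d + a * c * d + b * c * d) :
    a = 1 ∧ b = 1 ∧ c = 1 ∧ d = 1 := by
  have hkey := sum_mul_sub_four_eq h
  rw [hsum] at hkey
  have h1 : 0 ≤ 4 * (c + d) * (a - b) ^ 2 := by positivity
  have h2 : 0 ≤ 4 * (a + b) * (c - d) ^ 2 := by positivity
  have habcd : a + b - c - d = 0 := pow_eq_zero_iff two_ne_zero |>.1 (by nlinarith)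
  have hab2 : a + b = 2 := by linarith
  have hcd2 : c + d = 2 := by linarith
  rw [habcd, hab2, hcd2] at hkey
  have hab : a - b = 0 := pow_eq_zero_iff two_ne_zero |>.1 (by nlinarith)
  have hcd : c - d = 0 := pow_eq_zero_iff two_ne_zero |>.1 (by nlinarith)
  refine ⟨?_, ?_, ?_, ?_⟩ <;> linarith

end

/-- A polygon `v` circumscribed counterclockwise about the unit circle: its `i`-th side
`v i`, `v (i + 1)` touches the circle at `u i`, and both tangent segments from the vertex `v i`
have length `t i`. -/
structure IsTangentLengths {n : ℕ} [NeZero n] (v u : Fin n → ℂ) (t : Fin n → ℝ) : Prop where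
  norm_eq_one (i) : ‖u i‖ = 1
  nonneg (i) : 0 ≤ t i
  eq_left (i) : v i = u i * (1 - t i * I)
  eq_right (i) : v (i + 1) = u i * (1 + t (i + 1) * I)

namespace IsTangentLengths

section

variable {n : ℕ} [NeZero n] {v u : Fin n → ℂ} {t : Fin n → ℝ}

theorem of_isTangentAt
    (htan : ∀ i, (⟨0, 1⟩ : Sphere ℂ).IsTangentAt (u i) line[ℝ, v i, v (i + 1)])
    (hu : ∀ i, u i ∈ segment ℝ (v i) (v (i + 1))) (h0 : ∀ i, 0 ≤ doubleArea (v i) (v (i + 1)) 0) :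
    IsTangentLengths v u fun i => dist (v i) (u i) where
  norm_eq_one i := norm_eq_one_of_isTangentAt (htan i)
  nonneg _ := dist_nonneg
  eq_left i := (eq_mul_one_sub_and_eq_mul_one_add_of_isTangentAt (htan i) (hu i) (h0 i)).1
  eq_right i := by
    rw [← (htan i).dist_eq_of_mem_of_mem (htan (i + 1)) (right_mem_affineSpan_pair ℝ _ _)
      (left_mem_affineSpan_pair ℝ _ _)]
    exact (eq_mul_one_sub_and_eq_mul_one_add_of_isTangentAt (htan i) (hu i) (h0 i)).2

theorem ne_zero (h : IsTangentLengths v u t) (i : Fin n) : u i ≠ 0 :=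
  norm_ne_zero_iff.1 (by simp [h.norm_eq_one i])

theorem prod_one_add_eq_prod_one_sub (h : IsTangentLengths v u t) :
    ∏ i, (1 + t i * I) = ∏ i, (1 - t i * I) := by
  have hu : ∏ i, u i ≠ 0 := Finset.prod_ne_zero_iff.2 fun i _ => h.ne_zero i
  refine mul_left_cancel₀ hu ?_
  calc (∏ i, u i) * ∏ i, (1 + t i * I) = (∏ i, u i) * ∏ i, (1 + t (i + 1) * I) := by
        exact congrArg _
          (Equiv.prod_comp (Equiv.addRight (1 : Fin n)) fun i => 1 + t i * I).symm
    _ = ∏ i, v (i + 1) := by simp only [h.eq_right, Finset.prod_mul_distrib]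
    _ = ∏ i, v i := Equiv.prod_comp (Equiv.addRight (1 : Fin n)) v
    _ = (∏ i, u i) * ∏ i, (1 - t i * I) := by simp only [h.eq_left, Finset.prod_mul_distrib]

theorem doubleArea_zero (h : IsTangentLengths v u t) (i : Fin n) :
    doubleArea (v i) (v (i + 1)) 0 = t i + t (i + 1) := by
  rw [h.eq_right i, h.eq_left i, sub_eq_add_neg, ← neg_mul, ← ofReal_neg,
    doubleArea_mul_one_add (h.norm_eq_one i), sub_neg_eq_add, add_comm]

theorem midpoint_eq_iff (h : IsTangentLengths v u t) (i : Fin n) :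
    midpoint ℝ (v i) (v (i + 1)) = u i ↔ t (i + 1) = t i := by
  have hsub : midpoint ℝ (v i) (v (i + 1)) - u i = u i * ((t (i + 1) - t i : ℝ) * (I / 2)) := by
    rw [h.eq_right i, h.eq_left i, midpoint_eq_smul_add, real_smul, invOf_eq_inv]
    push_cast
    ring
  rw [← sub_eq_zero, hsub]
  simp [h.ne_zero, sub_eq_zero]

theorem vertex_succ_eq_I_mul (h : IsTangentLengths v u t) {i : Fin n} (h1 : t i = 1)
    (h2 : t (i + 1) = 1) : v (i + 1) = I * v i := by
  rw [h.eq_right i, h.eq_left i, h1, h2, ofReal_one]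
  linear_combination u i * I_sq

end

variable {v u : Fin 4 → ℂ} {t : Fin 4 → ℝ}

theorem sum_eq_esymm (h : IsTangentLengths v u t) :
    t 0 + t 1 + t 2 + t 3 =
      t 0 * t 1 * t 2 + t 0 * t 1 * t 3 + t 0 * t 2 * t 3 + t 1 * t 2 * t 3 := by
  have him := congrArg im h.prod_one_add_eq_prod_one_sub
  simp only [Fin.prod_univ_four, mul_im, mul_re, add_re, add_im, sub_re, sub_im, one_re, one_im,
    ofReal_re, ofReal_im, I_re, I_im] at him
  linear_combination him / 2

theorem four_le_sum (h : IsTangentLengths v u t) (hpos : 0 < ∑ i, t i) : 4 ≤ ∑ i, t i := by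
  rw [Fin.sum_univ_four] at hpos ⊢
  exact four_le_sum_of_eq_esymm (h.nonneg 0) (h.nonneg 1) (h.nonneg 2) (h.nonneg 3) hpos
    h.sum_eq_esymm

theorem length_eq_one_of_sum_eq_four (h : IsTangentLengths v u t) (hsum : ∑ i, t i = 4)
    (i : Fin 4) : t i = 1 := by
  rw [Fin.sum_univ_four] at hsum
  obtain ⟨h0, h1, h2, h3⟩ := eq_one_of_sum_eq_four (h.nonneg 0) (h.nonneg 1) (h.nonneg 2)
    (h.nonneg 3) hsum h.sum_eq_esymm
  fin_cases i <;> assumption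

theorem sum_eq_four_iff (h : IsTangentLengths v u t) (hpos : 0 < ∑ i, t i) :
    ∑ i, t i = 4 ↔ ∀ i, midpoint ℝ (v i) (v (i + 1)) = u i := by
  simp only [h.midpoint_eq_iff]
  refine ⟨fun hsum i => ?_, fun heq => ?_⟩
  · rw [h.length_eq_one_of_sum_eq_four hsum, h.length_eq_one_of_sum_eq_four hsum]
  · have h1 : t 1 = t 0 := heq 0
    have h2 : t 2 = t 0 := (heq 1).trans h1
    have h3 : t 3 = t 0 := (heq 2).trans h2
    have hesymm := h.sum_eq_esymm
    rw [h1, h2, h3] at hesymm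
    rw [Fin.sum_univ_four, h1, h2, h3] at hpos ⊢
    have h0 : 0 < t 0 := by linarith
    have hsq : t 0 ^ 2 = 1 := mul_left_cancel₀ h0.ne' (by linear_combination -hesymm / 4)
    rw [(pow_eq_one_iff_of_nonneg h0.le two_ne_zero).1 hsq]
    norm_num

theorem opposite_eq_neg (h : IsTangentLengths v u t) (hsum : ∑ i, t i = 4) (i : Fin 4) :
    v (i + 2) = -v i := by
  have hrot j : v (j + 1) = I * v j :=
    h.vertex_succ_eq_I_mul (h.length_eq_one_of_sum_eq_four hsum j)
      (h.length_eq_one_of_sum_eq_four hsum (j + 1))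
  rw [show i + 2 = i + 1 + 1 by decide +revert, hrot, hrot, ← mul_assoc, I_mul_I, neg_one_mul]

theorem volume_convexHull (h : IsTangentLengths v u t) (hv : IsCounterclockwise v) :
    volume.real (convexHull ℝ (Set.range v)) = ∑ i, t i := by
  have hshoelace : doubleArea (v 0) (v 1) (v 2) + doubleArea (v 2) (v 3) (v 0) =
      ∑ i, doubleArea (v i) (v (i + 1)) 0 := by
    rw [Fin.sum_univ_four]
    change _ = doubleArea (v 0) (v 1) 0 + doubleArea (v 1) (v 2) 0 + doubleArea (v 2) (v 3) 0 +
      doubleArea (v 3) (v 0) 0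
    simp only [doubleArea_apply, sub_re, sub_im, zero_re, zero_im]
    ring
  have hshift : ∑ i, t (i + 1) = ∑ i, t i := Equiv.sum_comp (Equiv.addRight (1 : Fin 4)) t
  rw [hv.volume_convexHull, hshoelace]
  simp only [h.doubleArea_zero, Finset.sum_add_distrib, hshift, add_self_div_two]

theorem sum_pos (h : IsTangentLengths v u t) (hv : IsCounterclockwise v) : 0 < ∑ i, t i := by
  rw [← h.volume_convexHull hv, hv.volume_convexHull]
  exact half_pos (add_pos (hv 0) (hv 2))

end IsTangentLengths

/-! ### Reduction to the unit circle -/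

theorem mul_pos_of_sSameSide {V P : Type*} [AddCommGroup V] [Module ℝ V] [AddTorsor V P]
    {f : P →ᵃ[ℝ] ℝ} {s : AffineSubspace ℝ P} (hf : ∀ p, p ∈ s ↔ f p = 0) {x y : P}
    (h : s.SSameSide x y) : 0 < f x * f y := by
  obtain ⟨⟨p, hp, q, hq, hray⟩, hx, hy⟩ := h
  rw [hf] at hp hq hx hy
  have hray' : SameRay ℝ (f x) (f y) := by
    simpa only [f.linearMap_vsub, hp, hq, vsub_eq_sub, sub_zero] using hray.map f.linear
  obtain ⟨r, hr, hrxy⟩ := hray'.exists_nonneg_left hx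
  refine lt_of_le_of_ne ?_ (mul_ne_zero hx hy).symm
  rw [← hrxy, smul_eq_mul, mul_left_comm]
  exact mul_nonneg hr (mul_self_nonneg _)

theorem parallel_map {k V P V' P' : Type*} [Ring k] [AddCommGroup V] [Module k V] [AddTorsor V P]
    [AddCommGroup V'] [Module k V'] [AddTorsor V' P'] {s₁ s₂ : AffineSubspace k P}
    (h : s₁.Parallel s₂) (f : P →ᵃ[k] P') : (s₁.map f).Parallel (s₂.map f) := by
  obtain ⟨v, rfl⟩ := h
  refine ⟨f.linear v, ?_⟩
  rw [AffineSubspace.map_map, AffineSubspace.map_map]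
  congr 1
  ext x
  exact f.map_vadd x v

theorem area_image_div_area_image (T : ℂ ≃ᵃ[ℝ] Plane) (s s' : Set ℂ) :
    area (T '' s) / area (T '' s') = volume.real s / volume.real s' := by
  obtain ⟨c, hc, hT⟩ := exists_measure_image_affineEquiv volume volume T
  simp only [area, measureReal_def, hT, ENNReal.toReal_mul, ENNReal.coe_toReal]
  exact mul_div_mul_left _ _ (NNReal.coe_ne_zero.2 hc)

namespace Ellipse

/-- An affine parametrisation of the plane carrying the unit circle of `ℂ` to the ellipse `E`. -/
def IsChart (E : Ellipse) (T : ℂ ≃ᵃ[ℝ] Plane) : Prop :=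
  ∀ z, E.form (T z) = ‖z‖ ^ 2

theorem exists_isChart (E : Ellipse) : ∃ T, E.IsChart T := by
  let b : Module.Basis (Fin 2) ℝ Plane := E.axes.toBasis.unitsSMul
    ![Units.mk0 E.a E.a_pos.ne', Units.mk0 E.b E.b_pos.ne']
  let T : ℂ ≃ᵃ[ℝ] Plane := (basisOneI.equivFun.trans b.equivFun.symm).toAffineEquiv.trans
    (AffineEquiv.constVAdd ℝ Plane E.center)
  have hre z : E.axes.repr (T z - E.center) 0 = z.re * E.a := by
    simp [T, b, Module.Basis.unitsSMul_apply, Units.smul_def]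
  have him z : E.axes.repr (T z - E.center) 1 = z.im * E.b := by
    simp [T, b, Module.Basis.unitsSMul_apply, Units.smul_def]
  refine ⟨T, fun z => ?_⟩
  rw [form, hre, him, mul_pow, mul_pow, mul_div_cancel_right₀ _ (pow_ne_zero 2 E.a_pos.ne'),
    mul_div_cancel_right₀ _ (pow_ne_zero 2 E.b_pos.ne'), Complex.sq_norm, normSq_apply, sq, sq]

theorem TangentAt.eq {E : Ellipse} {l : AffineSubspace ℝ Plane} {p q : Plane}
    (hp : E.TangentAt l p) (hq : E.TangentAt l q) : p = q :=
  Set.singleton_injective (hp.symm.trans hq)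

namespace IsChart

variable {E : Ellipse} {T : ℂ ≃ᵃ[ℝ] Plane}

theorem trans_conj (hT : E.IsChart T) : E.IsChart (conjAe.toLinearEquiv.toAffineEquiv.trans T) :=
  fun z => (hT _).trans (congrArg (· ^ 2) (norm_conj z))

theorem region_eq (hT : E.IsChart T) : E.region = T '' Metric.closedBall 0 1 := by
  ext p
  obtain ⟨z, rfl⟩ := T.surjective p
  rw [T.injective.mem_set_image, mem_closedBall_zero_iff, region, Set.mem_ofPred_eq, hT,
    sq_le_one_iff₀ (norm_nonneg z)]

theorem curve_eq (hT : E.IsChart T) : E.curve = T '' Metric.sphere 0 1 := by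
  ext p
  obtain ⟨z, rfl⟩ := T.surjective p
  rw [T.injective.mem_set_image, mem_sphere_zero_iff_norm, curve, Set.mem_ofPred_eq, hT,
    pow_eq_one_iff_of_nonneg (norm_nonneg z) two_ne_zero]

theorem isTangentAt (hT : E.IsChart T) {l : AffineSubspace ℝ ℂ} {u : ℂ}
    (h : E.TangentAt (l.map (T : ℂ →ᵃ[ℝ] Plane)) (T u)) :
    (⟨0, 1⟩ : Sphere ℂ).IsTangentAt u l := by
  refine isTangentAt_of_inter_eq_singleton (T.injective.image_injective ?_)
  rw [Set.image_inter T.injective, Set.image_singleton]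
  rw [TangentAt, hT.curve_eq] at h
  exact h

end IsChart

end Ellipse

section Quadrilateral

variable {D : Polygon Plane 4} {E : Ellipse} {T : ℂ ≃ᵃ[ℝ] Plane}

theorem map_line_symm_eq_sideLine (D : Polygon Plane 4) (T : ℂ ≃ᵃ[ℝ] Plane) (i : Fin 4) :
    line[ℝ, T.symm (D i), T.symm (D (i + 1))].map (T : ℂ →ᵃ[ℝ] Plane) = D.sideLine i := by
  simp [Polygon.sideLine, AffineSubspace.map_span, Set.image_pair]

theorem region_eq_image_convexHull (D : Polygon Plane 4) (T : ℂ ≃ᵃ[ℝ] Plane) :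
    D.region = T '' convexHull ℝ (Set.range fun i => T.symm (D i)) := by
  refine Eq.trans ?_ ((T : ℂ →ᵃ[ℝ] Plane).image_convexHull _).symm
  rw [← Set.range_comp]
  simp [Polygon.region, Function.comp_def]

theorem pos_or_neg_of_mul_pos {d : Fin 4 → ℝ} (h : ∀ i, 0 < d i * d (i + 1)) :
    (∀ i, 0 < d i) ∨ ∀ i, d i < 0 := by
  have h0 := mul_pos_iff.1 (h 0)
  have h1 := mul_pos_iff.1 (h 1)
  have h2 := mul_pos_iff.1 (h 2)
  simp only [Fin.forall_fin_succ]
  grind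

theorem isCounterclockwise_symm_or_symm_conj (hD : D.IsConvexQuadrilateral) (T : ℂ ≃ᵃ[ℝ] Plane) :
    IsCounterclockwise (fun i => T.symm (D i)) ∨
      IsCounterclockwise (fun i => conj (T.symm (D i))) := by
  set v : Fin 4 → ℂ := fun i => T.symm (D i)
  have hside i : line[ℝ, v i, v (i + 1)].SSameSide (v (i + 2)) (v (i + 3)) := by
    rw [← T.sSameSide_map_iff, map_line_symm_eq_sideLine]
    simpa [v] using hD i
  have hcycle (i : Fin 4) : i + 1 + 3 = i := by decide +revert
  have hnext (i : Fin 4) : i + 1 + 1 = i + 2 := by decide +revert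
  have hne i : v i ≠ v (i + 1) := by
    intro heq
    refine (hside (i + 1)).2.2 ?_
    rw [hcycle, heq]
    exact left_mem_affineSpan_pair ℝ _ _
  have hmul i : 0 < doubleArea (v i) (v (i + 1)) (v (i + 2)) *
      doubleArea (v (i + 1)) (v (i + 1 + 1)) (v (i + 1 + 2)) := by
    rw [← hnext i]
    have h := mul_pos_of_sSameSide (mem_line_iff_doubleArea_eq_zero (hne (i + 1))) (hside (i + 1))
    rwa [hcycle, doubleArea_rotate (v i), mul_comm] at h
  refine (pos_or_neg_of_mul_pos hmul).imp_right fun hneg i => ?_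
  rw [doubleArea_conj]
  exact neg_pos.2 (hneg i)

theorem exists_isChart_isCounterclockwise (hD : D.IsConvexQuadrilateral) (E : Ellipse) :
    ∃ T, E.IsChart T ∧ IsCounterclockwise fun i => T.symm (D i) := by
  obtain ⟨T, hT⟩ := E.exists_isChart
  rcases isCounterclockwise_symm_or_symm_conj hD T with h | h
  · exact ⟨T, hT, h⟩
  · exact ⟨_, hT.trans_conj, h⟩

theorem exists_isTangentLengths (hT : E.IsChart T)
    (hv : IsCounterclockwise fun i => T.symm (D i)) (hE : E.InscribedIn D) :
    ∃ u t, IsTangentLengths (fun i => T.symm (D i)) u t ∧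
      ∀ i, E.TangentAt (D.sideLine i) (T (u i)) := by
  obtain ⟨hsub, htan⟩ := hE
  choose q hq hqtan using htan
  have hzero : (0 : ℂ) ∈ convexHull ℝ (Set.range fun i => T.symm (D i)) := by
    rw [← T.injective.mem_set_image, ← region_eq_image_convexHull]
    refine hsub (hT.region_eq ▸ Set.mem_image_of_mem T ?_)
    exact Metric.mem_closedBall_self zero_le_one
  refine ⟨fun i => T.symm (q i), _, .of_isTangentAt (fun i => hT.isTangentAt ?_) (fun i => ?_)
    fun i => hv.convexHull_subset i hzero, fun i => ?_⟩
  · rw [map_line_symm_eq_sideLine, T.apply_symm_apply]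
    exact hqtan i
  · exact image_segment ℝ (T.symm : Plane →ᵃ[ℝ] ℂ) _ _ ▸ Set.mem_image_of_mem T.symm (hq i)
  · rw [T.apply_symm_apply]
    exact hqtan i

variable {u : Fin 4 → ℂ} {t : Fin 4 → ℝ}

theorem area_div_area_eq (hT : E.IsChart T) (hv : IsCounterclockwise fun i => T.symm (D i))
    (h : IsTangentLengths (fun i => T.symm (D i)) u t) :
    area E.region / area D.region = Real.pi / ∑ i, t i := by
  rw [hT.region_eq, region_eq_image_convexHull D T, area_image_div_area_image,
    h.volume_convexHull hv, measureReal_def, Complex.volume_closedBall]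
  simp

theorem tangentAtMidpoints_iff (h : ∀ i, E.TangentAt (D.sideLine i) (T (u i))) :
    E.TangentAtMidpoints D ↔ ∀ i, midpoint ℝ (T.symm (D i)) (T.symm (D (i + 1))) = u i := by
  refine forall_congr' fun i => ?_
  rw [← T.symm.map_midpoint, T.symm_apply_eq]
  exact ⟨fun hm => hm.eq (h i), fun hm => hm ▸ h i⟩

theorem isParallelogram_of_sum_eq_four (h : IsTangentLengths (fun i => T.symm (D i)) u t)
    (hsum : ∑ i, t i = 4) : D.IsParallelogram := by
  have hopp (i) : T.symm (D (i + 2)) = -T.symm (D i) := h.opposite_eq_neg hsum i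
  have hpar (i : Fin 4) : (D.sideLine i).Parallel (D.sideLine (i + 2)) := by
    rw [← map_line_symm_eq_sideLine D T, ← map_line_symm_eq_sideLine D T]
    refine parallel_map (AffineSubspace.affineSpan_pair_parallel_iff_exists_unit_smul'.2 ⟨-1, ?_⟩) _
    rw [add_right_comm i 2 1, hopp, hopp]
    simp [neg_add_eq_sub]
  exact ⟨hpar 0, hpar 1⟩

end Quadrilateral

theorem theorem2p1 (D : Polygon Plane 4) (hD : D.IsConvexQuadrilateral)
    (E : Ellipse) (hE : E.InscribedIn D) :
    area E.region / area D.region ≤ Real.pi / 4 ∧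
      (area E.region / area D.region = Real.pi / 4 ↔
        D.IsParallelogram ∧ E.TangentAtMidpoints D) := by
  obtain ⟨T, hT, hv⟩ := exists_isChart_isCounterclockwise hD E
  obtain ⟨u, t, ht, hu⟩ := exists_isTangentLengths hT hv hE
  have hpos : 0 < ∑ i, t i := ht.sum_pos hv
  have hratio : Real.pi / ∑ i, t i = Real.pi / 4 ↔ ∑ i, t i = 4 := by
    simp [div_eq_mul_inv, Real.pi_ne_zero]
  rw [area_div_area_eq hT hv ht, hratio, tangentAtMidpoints_iff hu]
  refine ⟨div_le_div_of_nonneg_left Real.pi_pos.le four_pos (ht.four_le_sum hpos),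
    fun h4 => ⟨isParallelogram_of_sum_eq_four ht h4, (ht.sum_eq_four_iff hpos).1 h4⟩,
    fun hmid => (ht.sum_eq_four_iff hpos).2 hmid.2⟩
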